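/- Let $(\mathcal R,\le,r)$ be a triple where $\le$ is a quasi order (reflexive and transitive) on the set $\mathcal R$ and $r:\mathbb N\times\mathcal R\to\mathcal{AR}$ is a surjection; write $r_n(A)=r(n,A)$ and $\mathcal{AR}_n=\{r_n(A):A\in\mathcal R\}$. For $a\in\mathcal{AR}$ and $A\in\mathcal R$ let $$[a,A]=\{B\in\mathcal R:\ B\le A\text{ and }a=r_n(B)\text{ for some }n\},\qquad [n,A]=[r_n(A),A],$$ and $\mathcal{AR}(A)=\{a\in\mathcal{AR}:[a,A]\ne\emptyset\}$. Assume: - (A.1) $r_0(A)$ is the same element of $\mathcal{AR}$, denoted $\emptyset$, for all $A\in\mathcal R$. - (A.2) If $A\ne B$ then $r_n(A)\ne r_n(B)$ for some $n$. - (A.3) If $r_n(A)=r_m(B)$ then $n=m$ and $r_i(A)=r_i(B)$ for all $i<n$. Let $|a|$ be the unique $n$ with $a\in\mathcal{AR}_n$. Assume further that there is a quasi order $\le_{\mathrm{fin}}$ on $\mathcal{AR}$ such that the following hold, where $\mathrm{depth}_A(a)=\min\{n: a\le_{\mathrm{fin}}r_n(A)\}$ for $A\in\mathcal R$ and $a\in\mathcal{AR}(A)$: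 - (A.4) $A\le B$ if and only if for every $n$ there is $m$ with $r_n(A)\le_{\mathrm{fin}}r_m(B)$; and $\{b\in\mathcal{AR}:b\le_{\mathrm{fin}}a\}$ is finite for every $a\in\mathcal{AR}$. - (A.5) If $a\in\mathcal{AR}(A)$ and $n=\mathrm{depth}_A(a)$, then $[a,B]\neq\emptyset$ for every $B\in[n,A]$, and for every $B\in[a,A]$ there is $A'\in[n,A]$ with $[a,A']\subseteq[a,B]$. - (A.6) If $a\in\mathcal{AR}(A)$ and $n=\mathrm{depth}_A(a)$, then for every $\mathcal O\subseteq\mathcal{AR}_{|a|+1}$ there is $B\in[n,A]$ such that $\{r_{|a|+1}(C):C\in[a,B]\}$ is contained in $\mathcal O$ or in its complement. Give $\mathcal{AR}$ the discrete topology and $\mathcal{AR}^{\mathbb N}$ the product topology, and identify $A\in\mathcal R$ with the sequence $(r_n(A))_{n\in\mathbb N}$; the metric topology of $\mathcal R$ is the subspace topology. Assume that $\mathcal R$ is metrically closed, that is, closed in $\mathcal{AR}^{\mathbb N}$. Then every Borel subset $\mathcal X$ of $\mathcal R$ with respect to the metric topology is Ramsey: for all $a\in\mathcal{AR}$ and $A\in\mathcal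 R$ with $[a,A]\neq\emptyset$ there is $B\in[a,A]$ such that $[a,B]\subseteq\mathcal X$ or $[a,B]\cap\mathcal X=\emptyset$. -/

import Mathlib

/-! Triples `(R, ≤, r)`: `≤` is a quasi order on `R` (a `Preorder`), and `r n A` is the `n`-th
approximation of `A`; the approximations form the type `AR`. -/

namespace RamseySpace

universe u v

variable {R : Type u} {AR : Type v}

/-- The set `AR_n` of all `n`-th approximations. -/
def approxLevel (r : ℕ → R → AR) (n : ℕ) : Set AR :=
  {a | ∃ A : R, r n A = a}

/-- The length `|a|`: the `n` with `a = r_n(A)` for some `A` (it exists when `r` is onto `AR`,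
and it is unique under (A.3)). -/
noncomputable def length (r : ℕ → R → AR) (a : AR) : ℕ :=
  sInf {n | a ∈ approxLevel r n}

/-- The neighborhood `[a, A]`. -/
def nbhd [Preorder R] (r : ℕ → R → AR) (a : AR) (A : R) : Set R :=
  {B | (∃ n, a = r n B) ∧ B ≤ A}

/-- The neighborhood `[n, A] = [r_n(A), A]`. -/
def nbhdNat [Preorder R] (r : ℕ → R → AR) (n : ℕ) (A : R) : Set R :=
  nbhd r (r n A) A

/-- The set `AR(A)` of those `a` with `[a, A] ≠ ∅`. -/
def approxBelow [Preorder R] (r : ℕ → R → AR) (A : R) : Set AR :=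
  {a | (nbhd r a A).Nonempty}

/-- `depth_A(a) = min {n : a ≤_fin r_n(A)}`; used for `a ∈ AR(A)` only, where the set is
nonempty by (A.4). -/
noncomputable def depth (r : ℕ → R → AR) (leFin : AR → AR → Prop) (A : R) (a : AR) : ℕ :=
  sInf {n | leFin a (r n A)}

/-- The map that identifies `A` with the sequence of its approximations. -/
def approxSeq (r : ℕ → R → AR) (A : R) : ℕ → AR :=
  fun n => r n A

/-- The product topology on `AR^ℕ`, with `AR` discrete. -/
abbrev seqTopology (AR : Type v) : TopologicalSpace (ℕ → AR) :=
  @Pi.topologicalSpace ℕ (fun _ => AR) (fun _ => ⊥)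

/-- The metric topology on `R`, inherited from `AR^ℕ`. -/
abbrev metricTopology (r : ℕ → R → AR) : TopologicalSpace R :=
  TopologicalSpace.induced (approxSeq r) (seqTopology AR)

/-- `R` is a closed subspace of `AR^ℕ`. -/
def MetricallyClosed (r : ℕ → R → AR) : Prop :=
  @IsClosed (ℕ → AR) (seqTopology AR) (Set.range (approxSeq r))

/-- The Borel sets of the metric topology. -/
def MetricBorel (r : ℕ → R → AR) (X : Set R) : Prop :=
  @MeasurableSet R (@borel R (metricTopology r)) X

/-- (A.1): all `A` have the same `0`-th approximation (the one called `∅`). -/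
def AxiomA1 (r : ℕ → R → AR) : Prop :=
  ∀ A B : R, r 0 A = r 0 B

/-- (A.2) -/
def AxiomA2 (r : ℕ → R → AR) : Prop :=
  ∀ A B : R, A ≠ B → ∃ n, r n A ≠ r n B

/-- (A.3) -/
def AxiomA3 (r : ℕ → R → AR) : Prop :=
  ∀ (n m : ℕ) (A B : R), r n A = r m B → n = m ∧ ∀ i < n, r i A = r i B

/-- (A.4) Finitization, for the relation `leFin`. -/
structure AxiomA4 [Preorder R] (r : ℕ → R → AR) (leFin : AR → AR → Prop) : Prop where
  refl : ∀ a, leFin a a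
  trans : ∀ a b c, leFin a b → leFin b c → leFin a c
  le_iff : ∀ A B : R, A ≤ B ↔ ∀ n, ∃ m, leFin (r n A) (r m B)
  finite : ∀ a, {b | leFin b a}.Finite

/-- (A.5) Amalgamation. -/
def AxiomA5 [Preorder R] (r : ℕ → R → AR) (leFin : AR → AR → Prop) : Prop :=
  ∀ (A : R) (a : AR) (n : ℕ), a ∈ approxBelow r A → depth r leFin A a = n →
    (∀ B ∈ nbhdNat r n A, (nbhd r a B).Nonempty) ∧
    (∀ B ∈ nbhd r a A, ∃ A' ∈ nbhdNat r n A, nbhd r a A' ⊆ nbhd r a B)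

/-- (A.6) Pigeon hole principle. -/
def AxiomA6 [Preorder R] (r : ℕ → R → AR) (leFin : AR → AR → Prop) : Prop :=
  ∀ (A : R) (a : AR) (n : ℕ), a ∈ approxBelow r A → depth r leFin A a = n →
    ∀ O : Set AR, O ⊆ approxLevel r (length r a + 1) →
      ∃ B ∈ nbhdNat r n A,
        r (length r a + 1) '' nbhd r a B ⊆ O ∨ r (length r a + 1) '' nbhd r a B ⊆ Oᶜ

/-- Ramsey subsets of `R`. -/
def IsRamsey [Preorder R] (r : ℕ → R → AR) (X : Set R) : Prop :=
  ∀ (a : AR) (A : R), (nbhd r a A).Nonempty →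
    ∃ B ∈ nbhd r a A, nbhd r a B ⊆ X ∨ nbhd r a B ∩ X = ∅

end RamseySpace

namespace RamseySpace

universe u v

variable {R : Type u} {AR : Type v} [Preorder R] {r : ℕ → R → AR} {leFin : AR → AR → Prop}

/-! The Ramsey sets contain the metrically open sets and are closed under complements and countable
unions. The tool is fusion (`exists_fusion`): a property of pairs `(b, B)` that is inherited by
smaller `B` and can be forced inside `[depth_B(b), B]` holds for all relevant `b` at once below a
single limit, which exists because the space is metrically closed.

Fusion starting from `[n, A]` can only treat `b` of depth at least `n`, while an end-extension of
`a` may have smaller depth than `a`. In that case (A.6) makes the next approximation after `a`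
unique below some `B`, so `a` can be lengthened without losing members of the neighborhood;
repeating this reaches an approximation of minimal depth (`exists_depthMinimal`).

Open sets are handled by combinatorial forcing with acceptance and rejection. For a countable union,
fusion decides more and more of the sets along longer approximations, after which the union
coincides with an open set on a neighborhood. -/

/-- The axioms used for the Ramsey theorem, for a fixed finitization `leFin`. -/
structure FinitizedSpace (r : ℕ → R → AR) (leFin : AR → AR → Prop) : Prop where
  closed : MetricallyClosed r
  a3 : AxiomA3 r
  a4 : AxiomA4 r leFin
  a5 : AxiomA5 r leFin
  a6 : AxiomA6 r leFin

/-- The end-extensions of `a`, including `a` itself. -/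
def extensions (r : ℕ → R → AR) (a : AR) : Set AR :=
  {b | ∃ (D : R) (j k : ℕ), j ≤ k ∧ r j D = a ∧ r k D = b}

/-- The depth of `a` in `A` is minimal among the depths of the end-extensions of `a`. -/
def DepthMinimal (r : ℕ → R → AR) (leFin : AR → AR → Prop) (A : R) (a : AR) : Prop :=
  ∀ b ∈ approxBelow r A, b ∈ extensions r a → depth r leFin A a ≤ depth r leFin A b

/-- `X` is decided on `[a, A]`. -/
def Decides (r : ℕ → R → AR) (X : Set R) (a : AR) (A : R) : Prop :=
  nbhd r a A ⊆ X ∨ nbhd r a A ∩ X = ∅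

/-- No nonempty `[b, C]` with `C ≤ B` is contained in `X`. -/
def Rejects (r : ℕ → R → AR) (X : Set R) (b : AR) (B : R) : Prop :=
  ∀ C ≤ B, (nbhd r b C).Nonempty → ¬ nbhd r b C ⊆ X

theorem nbhd_mono (a : AR) {A B : R} (h : B ≤ A) : nbhd r a B ⊆ nbhd r a A :=
  fun _ hC => ⟨hC.1, hC.2.trans h⟩

theorem approxBelow_mono {A B : R} (h : B ≤ A) : approxBelow r B ⊆ approxBelow r A :=
  fun a ha => ha.mono (nbhd_mono a h)

theorem self_mem_nbhdNat (n : ℕ) (A : R) : A ∈ nbhdNat r n A :=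
  ⟨⟨n, rfl⟩, le_rfl⟩

theorem Decides.mono {X : Set R} {a : AR} {A B : R} (h : Decides r X a A) (hBA : B ≤ A) :
    Decides r X a B := by
  rcases h with h | h
  · exact Or.inl ((nbhd_mono a hBA).trans h)
  · exact Or.inr (Set.subset_empty_iff.1
      (h ▸ Set.inter_subset_inter_left X (nbhd_mono a hBA)))

theorem Rejects.mono {X : Set R} {b : AR} {A B : R} (h : Rejects r X b A) (hBA : B ≤ A) :
    Rejects r X b B :=
  fun C hC => h C (hC.trans hBA)

theorem self_mem_extensions {A : R} {a : AR} (ha : a ∈ approxBelow r A) :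
    a ∈ extensions r a := by
  obtain ⟨D, ⟨j, hj⟩, -⟩ := ha
  exact ⟨D, j, j, le_rfl, hj.symm, hj.symm⟩

namespace FinitizedSpace

theorem agree (h : FinitizedSpace r leFin) {A B : R} {n : ℕ} (e : r n A = r n B) :
    ∀ i ≤ n, r i A = r i B := by
  intro i hi
  rcases hi.lt_or_eq with hi | rfl
  · exact (h.a3 n n A B e).2 i hi
  · exact e

theorem mem_nbhd (h : FinitizedSpace r leFin) {A B D : R} {n : ℕ} :
    B ∈ nbhd r (r n D) A ↔ r n B = r n D ∧ B ≤ A := by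
  constructor
  · rintro ⟨⟨m, hm⟩, hB⟩
    obtain rfl := (h.a3 _ _ _ _ hm).1
    exact ⟨hm.symm, hB⟩
  · rintro ⟨e, hB⟩
    exact ⟨⟨n, e.symm⟩, hB⟩

theorem mem_nbhdNat (h : FinitizedSpace r leFin) {A B : R} {n : ℕ} :
    B ∈ nbhdNat r n A ↔ r n B = r n A ∧ B ≤ A :=
  h.mem_nbhd

theorem nbhdNat_trans (h : FinitizedSpace r leFin) {A B C : R} {m n : ℕ} (hmn : m ≤ n)
    (hB : B ∈ nbhdNat r m A) (hC : C ∈ nbhdNat r n B) : C ∈ nbhdNat r m A := by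
  rw [h.mem_nbhdNat] at *
  exact ⟨(h.agree hC.1 m hmn).trans hB.1, hC.2.trans hB.2⟩

theorem length_approx (h : FinitizedSpace r leFin) (n : ℕ) (A : R) : length r (r n A) = n := by
  have : {m | r n A ∈ approxLevel r m} = {n} := by
    ext m
    constructor
    · rintro ⟨B, hB⟩
      exact (h.a3 _ _ _ _ hB).1
    · rintro rfl
      exact ⟨A, rfl⟩
  rw [length, this, csInf_singleton]

theorem nbhd_subset_of_extension (h : FinitizedSpace r leFin) {a b : AR}
    (hb : b ∈ extensions r a) (A : R) : nbhd r b A ⊆ nbhd r a A := by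
  obtain ⟨D, j, k, hjk, rfl, rfl⟩ := hb
  intro E hE
  rw [h.mem_nbhd] at hE ⊢
  exact ⟨h.agree hE.1 j hjk, hE.2⟩

/-! ### Depth -/

theorem leFin_depth (h : FinitizedSpace r leFin) {A : R} {a : AR} (ha : a ∈ approxBelow r A) :
    leFin a (r (depth r leFin A a) A) := by
  obtain ⟨D, ⟨j, rfl⟩, hD⟩ := ha
  exact Nat.sInf_mem ((h.a4.le_iff D A).1 hD j)

/-- Depth depends only on the approximations up to the depth. -/
theorem depth_eq (h : FinitizedSpace r leFin) {A B : R} {b : AR} {m : ℕ}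
    (hb : b ∈ approxBelow r A) (hm : depth r leFin A b ≤ m) (e : r m B = r m A) :
    depth r leFin B b = depth r leFin A b := by
  have hag := h.agree e
  have h1 : leFin b (r (depth r leFin A b) B) := by
    rw [hag _ hm]
    exact h.leFin_depth hb
  have hle : depth r leFin B b ≤ depth r leFin A b := Nat.sInf_le h1
  refine le_antisymm hle (Nat.sInf_le ?_)
  change leFin b (r (depth r leFin B b) A)
  rw [← hag _ (hle.trans hm)]
  exact Nat.sInf_mem (s := {n | leFin b (r n B)}) ⟨_, h1⟩

/-- Agreement up to `m` includes agreement up to the depth of `b`, where the first half of (A.5)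
applies. -/
theorem mem_approxBelow_of_mem_nbhdNat (h : FinitizedSpace r leFin) {A B : R} {b : AR} {m : ℕ}
    (hb : b ∈ approxBelow r A) (hm : depth r leFin A b ≤ m) (hB : B ∈ nbhdNat r m A) :
    b ∈ approxBelow r B := by
  rw [h.mem_nbhdNat] at hB
  exact (h.a5 A b _ hb rfl).1 B (h.mem_nbhdNat.2 ⟨h.agree hB.1 _ hm, hB.2⟩)

theorem depthMinimal_mono (h : FinitizedSpace r leFin) {A B : R} {a : AR}
    (ha : a ∈ approxBelow r A) (hA : DepthMinimal r leFin A a)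
    (hB : B ∈ nbhdNat r (depth r leFin A a) A) : DepthMinimal r leFin B a := by
  intro b hb hab
  rw [h.mem_nbhdNat] at hB
  have h1 := hA b (approxBelow_mono hB.2 hb) hab
  rw [h.depth_eq ha le_rfl hB.1]
  by_contra! hlt
  have := h.depth_eq hb hlt.le hB.1.symm
  omega

/-! ### Limits and fusion -/

/-- In a metrically closed space, sequences all of whose initial parts are approximated
come from an element. -/
theorem exists_limit (h : FinitizedSpace r leFin) (x : ℕ → AR) (A : ℕ → R)
    (hx : ∀ N, ∀ i ≤ N, r i (A N) = x i) : ∃ B, ∀ i, r i B = x i := by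
  let _ : TopologicalSpace AR := ⊥
  have hcl : IsClosed (Set.range (approxSeq r)) := h.closed
  have : x ∈ Set.range (approxSeq r) := by
    refine hcl.mem_of_tendsto (f := fun N => approxSeq r (A N)) (b := Filter.atTop) ?_
      (Filter.Eventually.of_forall fun N => ⟨_, rfl⟩)
    rw [tendsto_pi_nhds]
    intro i
    refine tendsto_const_nhds.congr' ?_
    filter_upwards [Filter.eventually_ge_atTop i] with N hN
    exact (hx N i hN).symm
  obtain ⟨B, hB⟩ := this
  exact ⟨B, fun i => congrFun hB i⟩

/-- One stage of a fusion: all `b ∈ S` of depth `m` are treated simultaneously. -/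
theorem exists_fusion_stage (h : FinitizedSpace r leFin) {S : Set AR} {P : AR → R → Prop} {A₀ : R}
    (hmono : ∀ b B B', P b B → B' ≤ B → P b B')
    (hdense : ∀ b ∈ S, ∀ B ≤ A₀, b ∈ approxBelow r B →
      ∃ B' ∈ nbhdNat r (depth r leFin B b) B, P b B')
    (A : R) (hA : A ≤ A₀) (m : ℕ) :
    ∃ A' ∈ nbhdNat r m A, ∀ b ∈ S, b ∈ approxBelow r A' → depth r leFin A b = m → P b A' := by
  have key : ∀ F : Set AR, F.Finite → ∃ A' ∈ nbhdNat r m A, ∀ b ∈ F, b ∈ S →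
      b ∈ approxBelow r A' → depth r leFin A b = m → P b A' := by
    intro F hF
    induction F, hF using Set.Finite.induction_on with
    | empty => exact ⟨A, self_mem_nbhdNat m A, by simp⟩
    | @insert c F _ _ ih =>
      obtain ⟨A', hA', hP⟩ := ih
      by_cases hc : c ∈ S ∧ c ∈ approxBelow r A' ∧ depth r leFin A c = m
      · obtain ⟨hcS, hcA', hcm⟩ := hc
        have hA'2 := h.mem_nbhdNat.1 hA'
        obtain ⟨B, hB, hPB⟩ := hdense c hcS A' (hA'2.2.trans hA) hcA'
        rw [h.depth_eq (approxBelow_mono hA'2.2 hcA') hcm.le hA'2.1, hcm] at hB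
        refine ⟨B, h.nbhdNat_trans le_rfl hA' hB, ?_⟩
        rintro b (rfl | hbF) hbS hbB hbm
        · exact hPB
        · exact hmono b A' B (hP b hbF hbS (approxBelow_mono hB.2 hbB) hbm) hB.2
      · refine ⟨A', hA', ?_⟩
        rintro b (rfl | hbF) hbS hbB hbm
        · exact absurd ⟨hbS, hbB, hbm⟩ hc
        · exact hP b hbF hbS hbB hbm
  -- Every `b` of depth `m` in `A` lies below `r m A`, so (A.4) leaves finitely many.
  obtain ⟨A', hA', hP⟩ := key _ (h.a4.finite (r m A))
  refine ⟨A', hA', fun b hbS hbA' hbm => hP b ?_ hbS hbA' hbm⟩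
  have := h.leFin_depth (approxBelow_mono hA'.2 hbA')
  rwa [hbm] at this

/-- The fusion lemma. -/
theorem exists_fusion (h : FinitizedSpace r leFin) {S : Set AR} {P : AR → R → Prop} {A : R} {n : ℕ}
    (hmono : ∀ b B B', P b B → B' ≤ B → P b B')
    (hdense : ∀ b ∈ S, ∀ B ≤ A, b ∈ approxBelow r B →
      ∃ B' ∈ nbhdNat r (depth r leFin B b) B, P b B')
    (hS : ∀ b ∈ S, b ∈ approxBelow r A → n ≤ depth r leFin A b) :
    ∃ B ∈ nbhdNat r n A, ∀ b ∈ S, b ∈ approxBelow r B → P b B := by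
  have stage := h.exists_fusion_stage hmono hdense
  choose f hf hfP using stage
  let T : ℕ → {C : R // C ≤ A} := fun k =>
    Nat.rec ⟨A, le_rfl⟩ (fun k C => ⟨f C.1 C.2 (n + k), (hf C.1 C.2 (n + k)).2.trans C.2⟩) k
  have hT : ∀ k, (T (k + 1)).1 ∈ nbhdNat r (n + k) (T k).1 := fun k => hf _ _ _
  have hTP : ∀ k, ∀ b ∈ S, b ∈ approxBelow r (T (k + 1)).1 →
      depth r leFin (T k).1 b = n + k → P b (T (k + 1)).1 := fun k => hfP _ _ _
  have hchain : ∀ k l, k ≤ l → (T l).1 ∈ nbhdNat r (n + k) (T k).1 := by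
    intro k l hkl
    induction l, hkl using Nat.le_induction with
    | base => exact self_mem_nbhdNat _ _
    | succ l hl ih => exact h.nbhdNat_trans (by omega) ih (hT l)
  have hag : ∀ k l i, k ≤ l → i ≤ n + k → r i (T l).1 = r i (T k).1 := fun k l i hkl hi =>
    h.agree (h.mem_nbhdNat.1 (hchain k l hkl)).1 i hi
  -- Stage `k` fixes the approximations up to `n + k`, so the diagonal sequence is coherent.
  obtain ⟨B, hB⟩ := h.exists_limit (fun i => r i (T i).1) (fun N => (T N).1)
    (fun N i hi => hag i N i hi (by omega))
  have hBT : ∀ k, ∀ i ≤ n + k, r i B = r i (T k).1 := by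
    intro k i hi
    rw [hB]
    rcases le_total k i with hki | hik
    · exact hag k i i hki hi
    · exact (hag i k i hik (by omega)).symm
  have hBle : ∀ k, B ≤ (T k).1 := by
    intro k
    rw [h.a4.le_iff]
    intro i
    rw [hBT (max i k) i (by omega)]
    exact (h.a4.le_iff _ _).1 (hchain k (max i k) (le_max_right _ _)).2 i
  refine ⟨B, h.mem_nbhdNat.2 ⟨hBT 0 n (by omega), hBle 0⟩, fun b hbS hbB => ?_⟩
  -- `B` and `A` agree up to `n`, so a depth below `n` in `B` would also be the depth in `A`.
  have hnd : n ≤ depth r leFin B b := by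
    by_contra! hlt
    have h1 := h.depth_eq hbB hlt.le (hBT 0 n (by omega)).symm
    have h2 := hS b hbS (approxBelow_mono (hBle 0) hbB)
    change depth r leFin A b = _ at h1
    omega
  obtain ⟨k, hk⟩ := Nat.exists_eq_add_of_le hnd
  refine hmono b _ B (hTP k b hbS (approxBelow_mono (hBle (k + 1)) hbB) ?_) (hBle (k + 1))
  rw [h.depth_eq hbB hk.le (hBT k (n + k) le_rfl).symm, hk]

/-! ### Reduction to minimal depth -/

/-- If an end-extension of `a` has smaller depth than `a`, then `a` has a unique one-step
extension below some `B`. -/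
theorem exists_unique_extension (h : FinitizedSpace r leFin) {A D : R} {j k : ℕ} (hD : D ≤ A)
    (hjk : j < k) (hlt : depth r leFin A (r k D) < depth r leFin A (r j D)) :
    ∃ B ∈ nbhdNat r (depth r leFin A (r j D)) A,
      ∀ C ∈ nbhd r (r j D) B, r (j + 1) C = r (j + 1) D := by
  have ha : r j D ∈ approxBelow r A := ⟨D, ⟨j, rfl⟩, hD⟩
  have hb : r k D ∈ approxBelow r A := ⟨D, ⟨k, rfl⟩, hD⟩
  obtain ⟨B, hB, hO⟩ := h.a6 A (r j D) _ ha rfl {r (length r (r j D) + 1) D} (by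
    rintro _ rfl
    exact ⟨D, rfl⟩)
  rw [h.length_approx] at hO
  refine ⟨B, hB, ?_⟩
  rcases hO with hO | hO
  · exact fun C hC => hO ⟨C, hC, rfl⟩
  -- The other color is impossible: `r k D` has smaller depth, so it survives below `B`, and its
  -- witness passes through `r (j + 1) D`.
  · obtain ⟨E, hE⟩ := h.mem_approxBelow_of_mem_nbhdNat hb hlt.le hB
    have hE' := h.mem_nbhd.1 hE
    exact absurd (h.agree hE'.1 (j + 1) hjk)
      (hO ⟨E, h.mem_nbhd.2 ⟨h.agree hE'.1 j hjk.le, hE'.2⟩, rfl⟩)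

/-- Here `d` counts the steps to an extension of least depth `m`. While the depth of `r j D` exceeds
`m`, its next approximation can be made unique, and `j` advances. -/
theorem exists_depthMinimal_aux (h : FinitizedSpace r leFin) (m d : ℕ) : ∀ (A D : R) (j : ℕ),
    D ≤ A → depth r leFin A (r (j + d) D) = m →
    (∀ b ∈ approxBelow r A, b ∈ extensions r (r j D) → m ≤ depth r leFin A b) →
    ∃ A' ≤ A, ∃ a' ∈ extensions r (r j D), a' ∈ approxBelow r A' ∧
      nbhd r (r j D) A' ⊆ nbhd r a' A' ∧ DepthMinimal r leFin A' a' := by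
  induction d with
  | zero =>
    intro A D j hD hm hmin
    refine ⟨A, le_rfl, r j D, ⟨D, j, j, le_rfl, rfl, rfl⟩, ⟨D, ⟨j, rfl⟩, hD⟩, subset_rfl, ?_⟩
    intro b hb hab
    exact hm.le.trans (hmin b hb hab)
  | succ d ih =>
    intro A D j hD hm hmin
    by_cases hle : depth r leFin A (r j D) ≤ m
    · refine ⟨A, le_rfl, r j D, ⟨D, j, j, le_rfl, rfl, rfl⟩, ⟨D, ⟨j, rfl⟩, hD⟩, subset_rfl, ?_⟩
      intro b hb hab
      exact hle.trans (hmin b hb hab)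
    push Not at hle
    have hb : r (j + (d + 1)) D ∈ approxBelow r A := ⟨D, ⟨_, rfl⟩, hD⟩
    obtain ⟨B, hB, huniq⟩ := h.exists_unique_extension (k := j + (d + 1)) hD (by omega)
      (hm ▸ hle)
    have hBA := h.mem_nbhdNat.1 hB
    -- `D` need not lie below `B`, but its approximation of depth `m` persists there.
    obtain ⟨D', hD'⟩ := h.mem_approxBelow_of_mem_nbhdNat hb (hm ▸ hle.le) hB
    rw [h.mem_nbhd] at hD'
    have e : ∀ i ≤ j + (d + 1), r i D' = r i D := h.agree hD'.1
    have hext : ∀ b ∈ extensions r (r (j + 1) D'), b ∈ extensions r (r j D) := by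
      rintro b ⟨E, j', k, hjk, hj', rfl⟩
      obtain rfl := (h.a3 _ _ _ _ hj').1
      refine ⟨E, j, k, by omega, ?_, rfl⟩
      rw [h.agree hj' j (by omega), e j (by omega)]
    obtain ⟨A', hA', a', ha', hne, hsub, hgood⟩ := ih B D' (j + 1) hD'.2 (by
        rw [show j + 1 + d = j + (d + 1) by omega, hD'.1,
          h.depth_eq hb (hm ▸ hle.le) hBA.1, hm]) (by
        intro b hbB hbe
        have h1 := hmin b (approxBelow_mono hBA.2 hbB) (hext b hbe)
        by_contra! hlt
        have h2 := h.depth_eq hbB (hlt.trans hle).le hBA.1.symm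
        omega)
    refine ⟨A', hA'.trans hBA.2, a', hext a' ha', hne, ?_, hgood⟩
    intro C hC
    apply hsub
    rw [h.mem_nbhd]
    exact ⟨(huniq C (nbhd_mono _ hA' hC)).trans (e (j + 1) (by omega)).symm, hC.2⟩

theorem exists_depthMinimal (h : FinitizedSpace r leFin) {A : R} {a : AR}
    (ha : a ∈ approxBelow r A) :
    ∃ A' ≤ A, ∃ a' ∈ extensions r a, a' ∈ approxBelow r A' ∧
      nbhd r a A' ⊆ nbhd r a' A' ∧ DepthMinimal r leFin A' a' := by
  let M : Set ℕ := {m | ∃ b ∈ approxBelow r A, b ∈ extensions r a ∧ depth r leFin A b = m}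
  have hM : M.Nonempty := ⟨_, a, ha, self_mem_extensions ha, rfl⟩
  obtain ⟨b, ⟨D, ⟨k, rfl⟩, hD⟩, ⟨E, j, k', hjk, rfl, hE⟩, hbm⟩ := Nat.sInf_mem hM
  obtain rfl := (h.a3 _ _ _ _ hE).1
  obtain ⟨d, rfl⟩ := Nat.exists_eq_add_of_le hjk
  have hj := h.agree hE j hjk
  rw [hj]
  refine h.exists_depthMinimal_aux (sInf M) d A D j hD hbm fun b hb hbe => Nat.sInf_le ?_
  rw [← hj] at hbe
  exact ⟨b, hb, hbe, rfl⟩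

/-- To show that `X` is Ramsey it suffices to treat those `[a, A]` in which the depth of `a` is
minimal among its end-extensions. -/
theorem isRamsey_of_depthMinimal (h : FinitizedSpace r leFin) {X : Set R}
    (hX : ∀ (A : R) (a : AR), a ∈ approxBelow r A → DepthMinimal r leFin A a →
      ∃ B ≤ A, a ∈ approxBelow r B ∧ Decides r X a B) : IsRamsey r X := by
  intro a A hne
  obtain ⟨A', hA', a', ha', hne', hsub, hgood⟩ := h.exists_depthMinimal hne
  obtain ⟨B, hB, ⟨E, hE⟩, hdec⟩ := hX A' a' hne' hgood
  have hEa : E ∈ nbhd r a A := nbhd_mono a (hB.trans hA') (h.nbhd_subset_of_extension ha' B hE)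
  have heq : nbhd r a E ⊆ nbhd r a' E := fun C hC =>
    ⟨(hsub (nbhd_mono a (hE.2.trans hB) hC)).1, hC.2⟩
  refine ⟨E, hEa, ?_⟩
  rcases hdec.mono hE.2 with hd | hd
  · exact Or.inl (heq.trans hd)
  · exact Or.inr (Set.subset_empty_iff.1 (hd ▸ Set.inter_subset_inter_left X heq))

/-! ### Open sets -/

/-- Sets that are open in the metric topology are Ramsey. -/
theorem isRamsey_of_locally (h : FinitizedSpace r leFin) {X : Set R}
    (hX : ∀ D ∈ X, ∃ j, ∀ E, r j E = r j D → E ∈ X) : IsRamsey r X := by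
  refine h.isRamsey_of_depthMinimal fun A a ha hgood => ?_
  obtain ⟨B, hB, hdec⟩ := h.exists_fusion (S := extensions r a)
    (P := fun b B => nbhd r b B ⊆ X ∨ Rejects r X b B) (A := A) (n := depth r leFin A a)
    (by
      rintro b B B' (hb | hb) hle
      · exact Or.inl ((nbhd_mono b hle).trans hb)
      · exact Or.inr (hb.mono hle))
    (by
      intro b _ B _ hb
      by_cases hrej : Rejects r X b B
      · exact ⟨B, self_mem_nbhdNat _ _, Or.inr hrej⟩
      · unfold Rejects at hrej
        push Not at hrej
        obtain ⟨C, hCB, ⟨D, hD⟩, hCX⟩ := hrej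
        -- Amalgamation turns `D`, which only preserves `b`, into a `B'` that preserves `B` up to
        -- the depth of `b`, as fusion requires.
        obtain ⟨B', hB', hsub⟩ := (h.a5 B b _ hb rfl).2 D (nbhd_mono b hCB hD)
        exact ⟨B', hB', Or.inl (hsub.trans ((nbhd_mono b hD.2).trans hCX))⟩)
    (fun b hb hbA => hgood b hbA hb)
  have haB := h.mem_approxBelow_of_mem_nbhdNat ha le_rfl hB
  rcases hdec a (self_mem_extensions ha) haB with hacc | hrej
  · exact ⟨B, hB.2, haB, Or.inl hacc⟩
  have hgoodB := h.depthMinimal_mono ha hgood hB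
  obtain ⟨C, hC, hstep⟩ := h.exists_fusion (S := extensions r a)
    (P := fun b C => Rejects r X b B → ∀ E ∈ nbhd r b C, ∀ k, r k E = b →
      Rejects r X (r (k + 1) E) B) (A := B) (n := depth r leFin B a)
    (by
      intro b C C' hP hle hr E hE
      exact hP hr E (nbhd_mono b hle hE))
    (by
      intro b hba C hCB hb
      by_cases hr : Rejects r X b B
      swap
      · exact ⟨C, self_mem_nbhdNat _ _, fun hr' => absurd hr' hr⟩
      -- Color one-step extensions by acceptance. If all were accepted, `[b, C']` would lie in `X`,
      -- against rejection of `b`.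
      obtain ⟨C', hC', hO⟩ := h.a6 C b _ hb rfl
        {c | c ∈ approxLevel r (length r b + 1) ∧ nbhd r c B ⊆ X} (fun c hc => hc.1)
      refine ⟨C', hC', fun _ E hE k hk => ?_⟩
      rcases hO with hO | hO
      · refine absurd ?_ (hr C' (hC'.2.trans hCB) ⟨E, hE⟩)
        intro F hF
        exact (hO ⟨F, hF, rfl⟩).2 ⟨⟨_, rfl⟩, hF.2.trans (hC'.2.trans hCB)⟩
      · have hEB : E ≤ B := hE.2.trans (hC'.2.trans hCB)
        have hnot := hO ⟨E, hE, rfl⟩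
        rw [← hk, h.length_approx] at hnot
        refine (hdec (r (k + 1) E) ?_ ⟨E, ⟨_, rfl⟩, hEB⟩).resolve_left
          fun hc => hnot ⟨⟨E, rfl⟩, hc⟩
        obtain ⟨D, i, l, hil, rfl, hl⟩ := hba
        rw [← hk] at hl
        obtain rfl := (h.a3 _ _ _ _ hl).1
        exact ⟨E, i, l + 1, by omega, (h.agree hl i hil).symm, rfl⟩)
    (fun b hb hbB => hgoodB b hbB hb)
  have haC := h.mem_approxBelow_of_mem_nbhdNat haB le_rfl hC
  refine ⟨C, hC.2.trans hB.2, haC, Or.inr ?_⟩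
  rw [Set.eq_empty_iff_forall_notMem]
  rintro E ⟨⟨⟨j, rfl⟩, hEC⟩, hEX⟩
  -- Rejection propagates along `E`, whereas openness makes a long enough approximation of `E`
  -- accepted.
  have hall : ∀ k, j ≤ k → Rejects r X (r k E) B := by
    intro k hk
    induction k, hk using Nat.le_induction with
    | base => exact hrej
    | succ k hk ih =>
      have hmem : E ∈ nbhd r (r k E) C := ⟨⟨k, rfl⟩, hEC⟩
      exact hstep (r k E) ⟨E, j, k, hk, rfl, rfl⟩ ⟨E, hmem⟩ ih E hmem k rfl
  obtain ⟨i, hi⟩ := hX E hEX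
  refine hall (max i j) (le_max_right _ _) B le_rfl ⟨E, ⟨_, rfl⟩, hEC.trans hC.2⟩ ?_
  intro F hF
  exact hi F (h.agree (h.mem_nbhd.1 hF).1 i (le_max_left _ _))

theorem exists_locally_of_isOpen (h : FinitizedSpace r leFin) {X : Set R}
    (hX : @IsOpen R (metricTopology r) X) : ∀ D ∈ X, ∃ j, ∀ E, r j E = r j D → E ∈ X := by
  let _ : TopologicalSpace AR := ⊥
  intro D hD
  obtain ⟨U, hU, rfl⟩ := hX
  obtain ⟨I, u, hu, hsub⟩ := isOpen_pi_iff.1 hU (approxSeq r D) hD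
  refine ⟨I.sup id, fun E hE => hsub ?_⟩
  intro i hi
  have : approxSeq r E i = approxSeq r D i := h.agree hE i (Finset.le_sup (f := id) hi)
  rw [this]
  exact (hu i hi).2

/-! ### Complements, countable unions and Borel sets -/

theorem isRamsey_compl {X : Set R} (hX : IsRamsey r X) : IsRamsey r Xᶜ := by
  intro a A hne
  obtain ⟨B, hB, hd⟩ := hX a A hne
  refine ⟨B, hB, hd.symm.imp ?_ ?_⟩
  · intro hd
    exact Set.subset_compl_iff_disjoint_right.2 (Set.disjoint_iff_inter_eq_empty.2 hd)
  · intro hd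
    exact Set.disjoint_iff_inter_eq_empty.1 (Set.disjoint_compl_right_iff_subset.2 hd)

/-- Inside some `[depth, B]`, finitely many Ramsey sets are decided simultaneously. -/
theorem exists_decides_finite (h : FinitizedSpace r leFin) {X : ℕ → Set R}
    (hX : ∀ i, IsRamsey r (X i)) {B : R} {b : AR} (hb : b ∈ approxBelow r B) (N : ℕ) :
    ∃ B' ∈ nbhdNat r (depth r leFin B b) B, ∀ i < N, Decides r (X i) b B' := by
  induction N with
  | zero => exact ⟨B, self_mem_nbhdNat _ _, by simp⟩
  | succ N ih =>
    obtain ⟨B', hB', hd⟩ := ih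
    have hb' := h.mem_approxBelow_of_mem_nbhdNat hb le_rfl hB'
    obtain ⟨C, hC, hCd⟩ := hX N b B' hb'
    obtain ⟨B'', hB'', hsub⟩ := (h.a5 B' b _ hb' rfl).2 C hC
    rw [h.depth_eq hb le_rfl (h.mem_nbhdNat.1 hB').1] at hB''
    refine ⟨B'', h.nbhdNat_trans le_rfl hB' hB'', fun i hi => ?_⟩
    rcases Nat.lt_succ_iff_lt_or_eq.1 hi with hi | rfl
    · exact (hd i hi).mono hB''.2
    · rcases hCd with hCd | hCd
      · exact Or.inl (hsub.trans hCd)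
      · exact Or.inr (Set.subset_empty_iff.1 (hCd ▸ Set.inter_subset_inter_left _ hsub))

theorem isRamsey_iUnion (h : FinitizedSpace r leFin) {X : ℕ → Set R}
    (hX : ∀ i, IsRamsey r (X i)) : IsRamsey r (⋃ i, X i) := by
  refine h.isRamsey_of_depthMinimal fun A a ha hgood => ?_
  obtain ⟨B, hB, hdec⟩ := h.exists_fusion (S := extensions r a)
    (P := fun b B => ∀ i < length r b + 1, Decides r (X i) b B) (A := A)
    (n := depth r leFin A a)
    (fun b B B' hP hle i hi => (hP i hi).mono hle)
    (fun b _ B _ hb => h.exists_decides_finite hX hb _)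
    (fun b hb hbA => hgood b hbA hb)
  have haB := h.mem_approxBelow_of_mem_nbhdNat ha le_rfl hB
  -- `U` depends on initial parts only, so it is open. A member of `X i` enters `U` through an
  -- approximation of length at least `i`, where `X i` has been decided.
  let U : Set R := {C | ∃ j i, nbhd r (r j C) B ⊆ X i}
  have hU : IsRamsey r U := by
    refine h.isRamsey_of_locally ?_
    rintro D ⟨j, i, hD⟩
    refine ⟨j, fun E hE => ⟨j, i, ?_⟩⟩
    rwa [hE]
  have hUX : ∀ C ∈ nbhd r a B, (C ∈ U ↔ C ∈ ⋃ i, X i) := by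
    rintro C ⟨⟨j, rfl⟩, hCB⟩
    rw [Set.mem_iUnion]
    constructor
    · rintro ⟨k, i, hk⟩
      exact ⟨i, hk ⟨⟨k, rfl⟩, hCB⟩⟩
    · rintro ⟨i, hi⟩
      have hmem : C ∈ nbhd r (r (max i j) C) B := ⟨⟨_, rfl⟩, hCB⟩
      refine ⟨max i j, i, (hdec (r (max i j) C)
        ⟨C, j, _, le_max_right _ _, rfl, rfl⟩ ⟨C, hmem⟩ i ?_).resolve_right ?_⟩
      · rw [h.length_approx]
        omega
      · exact Set.Nonempty.ne_empty ⟨C, hmem, hi⟩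
  obtain ⟨C, hC, hd⟩ := hU a B haB
  refine ⟨C, hC.2.trans hB.2, ⟨C, hC.1, le_rfl⟩, ?_⟩
  rcases hd with hd | hd
  · exact Or.inl fun E hE => (hUX E (nbhd_mono a hC.2 hE)).1 (hd hE)
  · refine Or.inr (Set.eq_empty_iff_forall_notMem.2 ?_)
    rintro E ⟨hE, hEX⟩
    exact Set.eq_empty_iff_forall_notMem.1 hd E ⟨hE, (hUX E (nbhd_mono a hC.2 hE)).2 hEX⟩

theorem isRamsey_of_metricBorel (h : FinitizedSpace r leFin) {X : Set R}
    (hX : MetricBorel r X) : IsRamsey r X := by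
  refine MeasurableSpace.generateFrom_induction {s | @IsOpen R (metricTopology r) s}
    (fun s _ => IsRamsey r s) ?_ ?_ ?_ ?_ X hX
  · exact fun t ht _ => h.isRamsey_of_locally (h.exists_locally_of_isOpen ht)
  · exact h.isRamsey_of_locally fun D hD => hD.elim
  · exact fun t _ ht => isRamsey_compl ht
  · exact fun s _ hs => h.isRamsey_iUnion hs

end FinitizedSpace

end RamseySpace

theorem corollary3p4 {R : Type*} {AR : Type*} [Preorder R] (r : ℕ → R → AR)
    (hr : Function.Surjective (Function.uncurry r))
    (hclosed : RamseySpace.MetricallyClosed r)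
    (h1 : RamseySpace.AxiomA1 r) (h2 : RamseySpace.AxiomA2 r) (h3 : RamseySpace.AxiomA3 r)
    (h456 : ∃ leFin : AR → AR → Prop, RamseySpace.AxiomA4 r leFin ∧
      RamseySpace.AxiomA5 r leFin ∧ RamseySpace.AxiomA6 r leFin)
    (X : Set R) (hX : RamseySpace.MetricBorel r X) :
    RamseySpace.IsRamsey r X := by
  obtain ⟨leFin, h4, h5, h6⟩ := h456
  exact RamseySpace.FinitizedSpace.isRamsey_of_metricBorel ⟨hclosed, h3, h4, h5, h6⟩ hX
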